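/- Let $\mathcal K$ be a Krein space, that is, a separable complex Hilbert space with a selfadjoint unitary operator $J$ on it. Let $H$ be a bounded linear operator on $\mathcal K$ which is $J$-hermitian, i.e. $H^*J=JH$, and suppose that $H-\lambda\mathbf 1$ is a Fredholm operator for every $\lambda\in\mathbb R$. Then every $\lambda\in\sigma(H)\cap\mathbb R$ is a discrete eigenvalue of $H$, i.e. $\lambda$ is an eigenvalue of $H$, it is an isolated point of the spectrum $\sigma(H)\subset\mathbb C$, and it has finite algebraic multiplicity: for every sufficiently small $r>0$ the Riesz projection $$P_\lambda(H)=\frac1{2\pi\imath}\oint_{|z-\lambda|=r}(z\mathbf 1-H)^{-1}\,dz$$ has finite-dimensional range. Moreover, $\sigma(H)\cap\mathbb R$ is a finite set. -/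

import Mathlib

open ContinuousLinearMap

noncomputable section

variable {K : Type*} [NormedAddCommGroup K] [InnerProductSpace ℂ K] [CompleteSpace K]

/-- A fundamental symmetry on a complex Hilbert space: a selfadjoint unitary operator. A separable
complex Hilbert space together with a fundamental symmetry is a Krein space. -/
structure IsFundamentalSymmetry (J : K →L[ℂ] K) : Prop where
  isSelfAdjoint : IsSelfAdjoint J
  mem_unitary : J ∈ unitary (K →L[ℂ] K)

/-- A bounded operator `H` is `J`-hermitian if `H* J = J H`. -/
def IsJHermitian (J H : K →L[ℂ] K) : Prop :=
  adjoint H * J = J * H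

/-- A `J`-hermitian operator `H` is `ℝ`-Fredholm if `H - t 1` is Fredholm for all real `t`. -/
structure IsRFredholm (J H : K →L[ℂ] K) : Prop where
  isJHermitian : IsJHermitian J H
  isFredholm : ∀ t : ℝ, IsFredholm (H - (t : ℂ) • (1 : K →L[ℂ] K))

/-- The Riesz integral `(2πi)⁻¹ ∮ (z - A)⁻¹ dz` along the positively oriented circle of radius `r`
around `c`. When the circle does not meet the spectrum of `A`, this is the Riesz projection of `A`
for the part of the spectrum of `A` inside the circle. -/
def rieszProjection (A : K →L[ℂ] K) (c : ℂ) (r : ℝ) : K →L[ℂ] K :=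
  (2 * (Real.pi : ℂ) * Complex.I)⁻¹ • ∮ z in C(c, r), resolvent A z

/-- `c` is a discrete eigenvalue of `A`: it is an eigenvalue which is an isolated point of the
spectrum of `A` in `ℂ`, and it has finite (algebraic) multiplicity, i.e. the range of the Riesz
projection of `A` at `c` is finite dimensional. -/
structure IsDiscreteEigenvalue (A : K →L[ℂ] K) (c : ℂ) : Prop where
  hasEigenvalue : Module.End.HasEigenvalue (A : K →ₗ[ℂ] K) c
  isolated_finite : ∃ r : ℝ, 0 < r ∧ Metric.closedBall c r ∩ spectrum ℂ A = {c} ∧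
    FiniteDimensional ℂ (rieszProjection A c r).range

end

/-! Fix a real t and put L = H - t. Since L* J = J L, the symmetry J maps ker L onto ker L* = (ran
L)^⊥, so L has equally large kernel and cokernel, and L + J P, with P the orthogonal projection onto
ker L, is invertible. Hence z - H is, near z = t, an invertible analytic family minus a fixed finite
rank operator. The Woodbury identity reduces its invertibility to that of an analytic matrix, whose
determinant either vanishes identically near t or has at most an isolated zero at t; in the second
case the resolvent has at most a pole at t.

The first case is open and closed in t on the real line and fails for large t, so it never occurs. A
pole of order at most m makes (t - H)^(m+1) annihilate the Riesz projection, so the range lies in a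
finite-dimensional generalized eigenspace. Finiteness follows since the compact real spectrum has no
accumulation point. -/

section MeromorphicInverse

/-! ### Local analytic Fredholm alternative -/

open Filter Topology

/-- Either a matrix depending analytically on `z` is singular near `t`, or it is invertible in a
punctured neighborhood of `t` and its inverse has at most a pole at `t`. -/
theorem Matrix.eventually_not_isUnit_or_exists_pow_smul_inv {ι : Type*} [Fintype ι] [DecidableEq ι]
    {M : ℂ → Matrix ι ι ℂ} {t : ℂ} (hM : ∀ i j, AnalyticAt ℂ (fun z => M z i j) t) :
    (∀ᶠ z in 𝓝 t, ¬IsUnit (M z)) ∨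
      ∃ (m : ℕ) (C : ℂ → Matrix ι ι ℂ), ContinuousAt C t ∧
        ∀ᶠ z in 𝓝[≠] t, IsUnit (M z) ∧ (z - t) ^ m • (M z)⁻¹ = C z := by
  have hd : AnalyticAt ℂ (fun z => (M z).det) t := by
    simp only [Matrix.det_apply']
    refine Finset.analyticAt_fun_sum _ fun σ _ => ?_
    exact analyticAt_const.mul (Finset.analyticAt_fun_prod _ fun i _ => hM _ _)
  have hMc : ContinuousAt M t :=
    tendsto_pi_nhds.2 fun i => tendsto_pi_nhds.2 fun j => (hM i j).continuousAt
  by_cases h0 : ∀ᶠ z in 𝓝 t, (M z).det = 0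
  · left
    filter_upwards [h0] with z hz
    simp [Matrix.isUnit_iff_isUnit_det, hz]
  · right
    obtain ⟨m, g, hg, hg0, hfac⟩ := hd.exists_eventuallyEq_pow_smul_nonzero_iff.2 h0
    -- Cramer's rule with det M = (z - t)^m g and g(t) ≠ 0.
    refine ⟨m, fun z => (g z)⁻¹ • (M z).adjugate, (hg.continuousAt.inv₀ hg0).smul ?_, ?_⟩
    · exact (Continuous.matrix_adjugate continuous_id).continuousAt.comp hMc
    · filter_upwards [hfac.filter_mono nhdsWithin_le_nhds, self_mem_nhdsWithin,
        (hg.continuousAt.eventually_ne hg0).filter_mono nhdsWithin_le_nhds] with z hz hzt hgz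
      have hp : (z - t) ^ m ≠ 0 := pow_ne_zero _ (sub_ne_zero.2 hzt)
      have hdet : (M z).det ≠ 0 := by
        rw [hz]
        exact smul_ne_zero hp hgz
      refine ⟨(Matrix.isUnit_iff_isUnit_det _).2 hdet.isUnit, ?_⟩
      rw [Matrix.inv_def, hz, Ring.inverse_eq_inv', smul_smul, smul_eq_mul, mul_inv,
        mul_inv_cancel_left₀ hp]

/-- Either an endomorphism of a finite dimensional space depending analytically on `z` is singular
near `t`, or it is invertible in a punctured neighborhood of `t` and its inverse has at most a pole
at `t`. -/
theorem ContinuousLinearMap.eventually_not_isUnit_or_exists_pow_smul_inverse_of_finiteDimensional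
    {W : Type*} [NormedAddCommGroup W] [NormedSpace ℂ W] [FiniteDimensional ℂ W]
    {N : ℂ → W →L[ℂ] W} {t : ℂ} (hN : AnalyticAt ℂ N t) :
    (∀ᶠ z in 𝓝 t, ¬IsUnit (N z)) ∨
      ∃ (m : ℕ) (C : ℂ → W →L[ℂ] W), ContinuousAt C t ∧
        ∀ᶠ z in 𝓝[≠] t, IsUnit (N z) ∧ (z - t) ^ m • Ring.inverse (N z) = C z := by
  let b := Module.finBasis ℂ W
  let e : (W →L[ℂ] W) ≃ₐ[ℂ] Matrix _ _ ℂ :=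
    (Module.End.toContinuousLinearMap W).symm.trans (LinearMap.toMatrixAlgEquiv b)
  have hu (z : ℂ) : IsUnit (e (N z)) ↔ IsUnit (N z) := MulEquiv.isUnit_map e
  have hM (i j) : AnalyticAt ℂ (fun z => e (N z) i j) t := by
    let l : (W →L[ℂ] W) →L[ℂ] ℂ :=
      LinearMap.toContinuousLinearMap ((Matrix.entryLinearMap ℂ ℂ i j).comp e.toLinearMap)
    exact l.analyticAt _ |>.comp hN
  refine (Matrix.eventually_not_isUnit_or_exists_pow_smul_inv hM).imp ?_ ?_
  · simp only [hu, imp_self]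
  · rintro ⟨m, C, hC, h⟩
    refine ⟨m, fun z => e.symm (C z), ?_, ?_⟩
    · exact (LinearMap.continuous_of_finiteDimensional e.symm.toLinearMap).continuousAt.comp hC
    · filter_upwards [h] with z hz
      refine ⟨(hu z).1 hz.1, ?_⟩
      rw [← hz.2, map_smul]
      congr 1
      refine left_inv_eq_right_inv (Ring.inverse_mul_cancel _ ((hu z).1 hz.1)) (e.injective ?_)
      rw [map_mul, map_one, AlgEquiv.apply_symm_apply,
        Matrix.mul_nonsing_inv _ ((Matrix.isUnit_iff_isUnit_det _).1 hz.1)]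

/-- The Woodbury identity for operators, together with the criterion for invertibility. -/
theorem ContinuousLinearMap.isUnit_sub_comp_iff_and_inverse_eq
    {E W : Type*} [NormedAddCommGroup E] [NormedSpace ℂ E]
    [NormedAddCommGroup W] [NormedSpace ℂ W] {X : E →L[ℂ] E} (hX : IsUnit X)
    (U : W →L[ℂ] E) (V : E →L[ℂ] W) :
    (IsUnit (X - U ∘L V) ↔ IsUnit (1 - V ∘L Ring.inverse X ∘L U)) ∧
      (IsUnit (1 - V ∘L Ring.inverse X ∘L U) → Ring.inverse (X - U ∘L V) =
        Ring.inverse X + Ring.inverse X ∘L U ∘L Ring.inverse (1 - V ∘L Ring.inverse X ∘L U) ∘L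
          V ∘L Ring.inverse X) := by
  set Y := Ring.inverse X with hY
  have hXY (x : E) : X (Y x) = x := congr($(Ring.mul_inverse_cancel X hX) x)
  have hYX (x : E) : Y (X x) = x := congr($(Ring.inverse_mul_cancel X hX) x)
  have key (hN : IsUnit (1 - V ∘L Y ∘L U)) : ∃ u : (E →L[ℂ] E)ˣ, (u : E →L[ℂ] E) = X - U ∘L V ∧
      ((u⁻¹ : (E →L[ℂ] E)ˣ) : E →L[ℂ] E) =
        Y + Y ∘L U ∘L Ring.inverse (1 - V ∘L Y ∘L U) ∘L V ∘L Y := by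
    set Q := Ring.inverse (1 - V ∘L Y ∘L U) with hQ
    have h1 (w : W) : Q w - V (Y (U (Q w))) = w := congr($(Ring.mul_inverse_cancel _ hN) w)
    have h2 (w : W) : Q (w - V (Y (U w))) = w := congr($(Ring.inverse_mul_cancel _ hN) w)
    refine ⟨⟨X - U ∘L V, Y + Y ∘L U ∘L Q ∘L V ∘L Y, ?_, ?_⟩, rfl, rfl⟩
    · ext x
      have := congrArg U (h1 (V (Y x)))
      simp only [_root_.map_sub] at this
      simp only [mul_def, add_apply, sub_apply, comp_apply, one_apply_eq_self, _root_.map_add, hXY]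
      linear_combination (norm := module) this
    · ext x
      have := congrArg (fun w => Y (U w)) (h2 (V x))
      simp only [_root_.map_sub] at this
      simp only [mul_def, add_apply, sub_apply, comp_apply, one_apply_eq_self, _root_.map_sub, hYX]
      linear_combination (norm := module) this
  refine ⟨⟨fun h => ?_, fun h => ?_⟩, fun h => ?_⟩
  · set S := Ring.inverse (X - U ∘L V) with hS
    have h1 (x : E) : X (S x) - U (V (S x)) = x := congr($(Ring.mul_inverse_cancel _ h) x)
    have h2 (x : E) : S (X x - U (V x)) = x := congr($(Ring.inverse_mul_cancel _ h) x)
    refine ⟨⟨1 - V ∘L Y ∘L U, 1 + V ∘L S ∘L U, ?_, ?_⟩, rfl⟩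
    · ext w
      have := congrArg (fun x => V (Y x)) (h1 (U w))
      simp only [_root_.map_sub, hYX] at this
      simp only [mul_def, add_apply, sub_apply, comp_apply, one_apply_eq_self, _root_.map_add]
      linear_combination (norm := module) this
    · ext w
      have := congrArg V (h2 (Y (U w)))
      simp only [_root_.map_sub, hXY] at this
      simp only [mul_def, add_apply, sub_apply, comp_apply, one_apply_eq_self, _root_.map_sub]
      linear_combination (norm := module) this
  · obtain ⟨u, hu, -⟩ := key h
    exact ⟨u, hu⟩
  · obtain ⟨u, hu, hu'⟩ := key h
    rw [← hu, Ring.inverse_unit, hu']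

/-- The local analytic Fredholm alternative: if `X` is analytic and invertible at `t`, then a
perturbation of `X` by an operator factoring through a finite dimensional space is either singular
near `t`, or invertible in a punctured neighborhood of `t` with inverse having at most a pole. -/
theorem ContinuousLinearMap.eventually_not_isUnit_or_exists_pow_smul_inverse
    {E W : Type*} [NormedAddCommGroup E] [NormedSpace ℂ E] [CompleteSpace E]
    [NormedAddCommGroup W] [NormedSpace ℂ W] [FiniteDimensional ℂ W]
    {X : ℂ → E →L[ℂ] E} {t : ℂ} (hX : AnalyticAt ℂ X t) (hXt : IsUnit (X t))
    (U : W →L[ℂ] E) (V : E →L[ℂ] W) :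
    (∀ᶠ z in 𝓝 t, ¬IsUnit (X z - U ∘L V)) ∨
      ∃ (m : ℕ) (C : ℂ → E →L[ℂ] E), ContinuousAt C t ∧
        ∀ᶠ z in 𝓝[≠] t, IsUnit (X z - U ∘L V) ∧
          (z - t) ^ m • Ring.inverse (X z - U ∘L V) = C z := by
  have hY : AnalyticAt ℂ (fun z => Ring.inverse (X z)) t := by
    obtain ⟨u, hu⟩ := hXt
    exact AnalyticAt.comp (hu ▸ analyticAt_inverse (𝕜 := ℂ) u) hX
  have hXu : ∀ᶠ z in 𝓝 t, IsUnit (X z) := hX.continuousAt.eventually (Units.isOpen.mem_nhds hXt)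
  have hN : AnalyticAt ℂ (fun z => 1 - V ∘L Ring.inverse (X z) ∘L U) t := by
    refine analyticAt_const.sub ?_
    exact ((compL ℂ W E W V).comp ((compL ℂ W E E).flip U)).analyticAt _ |>.comp hY
  refine (eventually_not_isUnit_or_exists_pow_smul_inverse_of_finiteDimensional hN).imp ?_ ?_
  · intro h
    filter_upwards [h, hXu] with z hz hzu
    rwa [(isUnit_sub_comp_iff_and_inverse_eq hzu U V).1]
  · rintro ⟨m, C, hC, h⟩
    have hYc := hY.continuousAt
    refine ⟨m, fun z => (z - t) ^ m • Ring.inverse (X z) +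
      Ring.inverse (X z) ∘L U ∘L C z ∘L V ∘L Ring.inverse (X z), ?_, ?_⟩
    · refine ContinuousAt.add (by fun_prop) ?_
      exact hYc.clm_comp (continuousAt_const.clm_comp
        (hC.clm_comp (continuousAt_const.clm_comp hYc)))
    · filter_upwards [h, hXu.filter_mono nhdsWithin_le_nhds] with z hz hzu
      obtain ⟨h1, h2⟩ := isUnit_sub_comp_iff_and_inverse_eq hzu U V
      refine ⟨h1.2 hz.1, ?_⟩
      rw [h2 hz.1, ← hz.2]
      simp only [smul_add, smul_comp, comp_smul]

end MeromorphicInverse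

/-! ### Contour integrals of a resolvent with a pole -/

section RieszProjection

open Filter Topology

variable {E : Type*} [NormedAddCommGroup E] [NormedSpace ℂ E] [CompleteSpace E]

theorem ContinuousLinearMap.circleIntegral_comp_comm {F : Type*} [NormedAddCommGroup F]
    [NormedSpace ℂ F] [CompleteSpace F] (L : E →L[ℂ] F) {f : ℂ → E} {c : ℂ} {R : ℝ}
    (hf : CircleIntegrable f c R) : (∮ z in C(c, R), L (f z)) = L (∮ z in C(c, R), f z) := by
  simp only [circleIntegral, ← L.map_smul]
  exact L.intervalIntegral_comp_comm hf.out

variable {A : Type*} [NormedRing A] [NormedAlgebra ℂ A] [CompleteSpace A]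

theorem continuousOn_resolvent_sphere {a : A} {c : ℂ} {r : ℝ}
    (hs : ∀ z ∈ Metric.sphere c r, z ∉ spectrum ℂ a) :
    ContinuousOn (resolvent a) (Metric.sphere c r) := fun z hz =>
  (spectrum.hasDerivAt_resolvent_const_left
    (spectrum.notMem_iff.1 (hs z hz))).continuousAt.continuousWithinAt

/-- Multiplying the contour integral of the resolvent of `a` by a power of `c - a` amounts to
inserting the same power of `c - z` into the integrand. -/
theorem algebraMap_sub_pow_mul_circleIntegral_resolvent {a : A} {c : ℂ} {r : ℝ} (hr : 0 ≤ r)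
    (hs : ∀ z ∈ Metric.sphere c r, z ∉ spectrum ℂ a) (k : ℕ) :
    (algebraMap ℂ A c - a) ^ k * (∮ z in C(c, r), resolvent a z) =
      ∮ z in C(c, r), (c - z) ^ k • resolvent a z := by
  have hcont := continuousOn_resolvent_sphere hs
  have hint (k : ℕ) : CircleIntegrable (fun z => (c - z) ^ k • resolvent a z) c r :=
    (ContinuousOn.smul (by fun_prop) hcont).circleIntegrable hr
  induction k with
  | zero => simp
  | succ k ih =>
    have hone : (∮ z in C(c, r), (c - z) ^ k • (1 : A)) = 0 :=
      Complex.circleIntegral_eq_zero_of_differentiable_on_off_countable hr Set.countable_empty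
        (by fun_prop) fun z _ => by fun_prop
    have hone' : CircleIntegrable (fun z => (c - z) ^ k • (1 : A)) c r :=
      ContinuousOn.circleIntegrable hr (by fun_prop)
    rw [pow_succ', mul_assoc, ih]
    refine ((ContinuousLinearMap.mul ℂ A (algebraMap ℂ A c - a)).circleIntegral_comp_comm
      (hint k)).symm.trans ?_
    rw [← add_zero (∮ z in C(c, r), (c - z) ^ (k + 1) • resolvent a z), ← hone,
      ← circleIntegral.integral_add (hint _) hone']
    refine circleIntegral.integral_congr hr fun z hz => ?_
    have hmul : (algebraMap ℂ A z - a) * resolvent a z = 1 :=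
      Ring.mul_inverse_cancel _ (spectrum.notMem_iff.1 (hs z hz))
    -- The summand z - a cancels the resolvent, leaving a polynomial whose contour integral
    -- vanishes.
    have hsplit : algebraMap ℂ A c - a = (c - z) • (1 : A) + (algebraMap ℂ A z - a) := by
      rw [Algebra.algebraMap_eq_smul_one, Algebra.algebraMap_eq_smul_one]
      module
    simp only [ContinuousLinearMap.mul_apply', mul_smul_comm, hsplit, add_mul, hmul, smul_mul_assoc,
      one_mul, smul_add, smul_smul, pow_succ]

/-- If the resolvent of `a` has at most a pole at an isolated point `c` of the spectrum, then a power
of `c - a` annihilates the Riesz integral around `c`. -/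
theorem exists_pow_mul_circleIntegral_resolvent_eq_zero {a : A} {c : ℂ} {r : ℝ} (hr : 0 ≤ r)
    (hs : ∀ z ∈ Metric.closedBall c r, z ≠ c → z ∉ spectrum ℂ a) {m : ℕ} {C : ℂ → A}
    (hC : ContinuousAt C c) (hpole : ∀ᶠ z in 𝓝[≠] c, (z - c) ^ m • resolvent a z = C z) :
    (algebraMap ℂ A c - a) ^ (m + 1) * (∮ z in C(c, r), resolvent a z) = 0 := by
  rcases hr.eq_or_lt with rfl | hr0
  · simp
  have hdiff (z : ℂ) (hz : z ∈ Metric.closedBall c r) (hzc : z ≠ c) :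
      DifferentiableAt ℂ (fun z => (c - z) ^ (m + 1) • resolvent a z) z :=
    DifferentiableAt.smul (c := fun z => (c - z) ^ (m + 1)) (by fun_prop)
      (spectrum.hasDerivAt_resolvent_const_left (spectrum.notMem_iff.1 (hs z hz hzc))).differentiableAt
  rw [algebraMap_sub_pow_mul_circleIntegral_resolvent hr fun z hz =>
    hs z (Metric.sphere_subset_closedBall hz) (Metric.ne_of_mem_sphere hz hr0.ne')]
  refine Complex.circleIntegral_eq_zero_of_differentiable_on_off_countable hr (Set.countable_singleton c)
    (fun z hz => ?_) fun z hz => hdiff z (Metric.ball_subset_closedBall hz.1) hz.2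
  rcases eq_or_ne z c with rfl | hzc
  · refine ContinuousAt.continuousWithinAt ?_
    rw [← continuousWithinAt_compl_self, ContinuousWithinAt, sub_self, zero_pow m.succ_ne_zero,
      zero_smul]
    have hlim : Tendsto (fun w => ((-1) ^ (m + 1) * (w - z)) • C w) (𝓝[≠] z) (𝓝 0) := by
      have : ContinuousAt (fun w => ((-1) ^ (m + 1) * (w - z)) • C w) z :=
        ContinuousAt.smul (by fun_prop) hC
      simpa using this.tendsto.mono_left nhdsWithin_le_nhds
    refine hlim.congr' ?_
    filter_upwards [hpole] with w hw
    rw [← hw, smul_smul, ← neg_sub w z, neg_pow (w - z)]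
    ring_nf
  · exact (hdiff z hz hzc).continuousAt.continuousWithinAt

/-- By induction: f^n maps ker f^(n+1) into ker f, and the kernel of this map embeds in ker f^n. -/
theorem Module.End.finiteDimensional_ker_pow {k V : Type*} [Field k] [AddCommGroup V] [Module k V]
    (f : Module.End k V) [FiniteDimensional k (LinearMap.ker f)] (n : ℕ) :
    FiniteDimensional k (LinearMap.ker (f ^ n)) := by
  induction n with
  | zero => rw [pow_zero, Module.End.one_eq_id, LinearMap.ker_id]; infer_instance
  | succ n ih =>
    rw [pow_succ', Module.End.mul_eq_comp, LinearMap.ker_comp]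
    let g : (LinearMap.ker f).comap (f ^ n) →ₗ[k] LinearMap.ker f :=
      (f ^ n).restrict fun x hx => hx
    have : FiniteDimensional k (LinearMap.ker g) := by
      let i : LinearMap.ker g →ₗ[k] LinearMap.ker (f ^ n) :=
        LinearMap.codRestrict _ ((Submodule.subtype _).comp (Submodule.subtype _)) fun x =>
          congrArg Subtype.val (LinearMap.mem_ker.1 x.2)
      exact FiniteDimensional.of_injective i fun x y h =>
        Subtype.ext (Subtype.ext (congrArg (fun w : LinearMap.ker (f ^ n) => (w : V)) h))
    have hfg : (LinearMap.ker g).FG := Module.Finite.iff_fg.1 this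
    rw [FiniteDimensional, Module.finite_def]
    refine Submodule.fg_of_fg_map_of_fg_inf_ker g ?_ (by rwa [top_inf_eq])
    exact IsNoetherian.noetherian _
end RieszProjection

/-! ### Real spectrum of ℝ-Fredholm operators -/

section Krein

open Filter Topology

variable {K : Type*} [NormedAddCommGroup K] [InnerProductSpace ℂ K] [CompleteSpace K]

theorem IsFundamentalSymmetry.apply_apply {J : K →L[ℂ] K} (hJ : IsFundamentalSymmetry J) (x : K) :
    J (J x) = x := by
  have h := (Unitary.mem_iff.1 hJ.mem_unitary).1
  rw [hJ.isSelfAdjoint.star_eq] at h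
  exact congr($h x)

/-- A `J`-hermitian Fredholm operator becomes invertible after adding the finite rank operator given
by the orthogonal projection onto the kernel followed by `J`. -/
theorem IsJHermitian.isUnit_add_comp_orthogonalProjection_ker {J L : K →L[ℂ] K}
    (hJ : IsFundamentalSymmetry J) (hL : IsJHermitian J L) (hF : IsFredholm L)
    [FiniteDimensional ℂ L.ker] :
    IsUnit (L + (J ∘L L.ker.subtypeL) ∘L L.ker.orthogonalProjectionOnto) := by
  have hadj (x : K) : adjoint L (J x) = J (L x) := congr($hL x)
  rw [isUnit_iff_bijective]
  constructor
  · rw [injective_iff_map_eq_zero]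
    intro x hx
    set p := L.ker.orthogonalProjectionOnto x with hp
    have hx' : L x + J p = 0 := hx
    -- J p = -L x lies both in the range and in its orthogonal complement, so it vanishes.
    have hJp : J p ∈ L.rangeᗮ := by
      rw [orthogonal_range]
      change adjoint L (J p) = 0
      rw [hadj, show L p = 0 from p.2, map_zero]
    have hJp' : J p ∈ L.range := ⟨-x, by
      rw [map_neg]
      exact neg_eq_of_add_eq_zero_right hx'⟩
    have hJp0 : J p = 0 := Submodule.disjoint_def.1 L.range.orthogonal_disjoint _ hJp' hJp
    have hp0 : (p : K) = 0 := by rw [← hJ.apply_apply p, hJp0, map_zero]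
    have hxk : x ∈ L.ker := by
      rw [hJp0, add_zero] at hx'
      exact hx'
    rw [← hp0, hp]
    exact (L.ker.starProjection_eq_self_iff.2 hxk).symm
  · intro y
    have : CompleteSpace L.range := hF.isClosed_range.completeSpace_coe
    obtain ⟨_, ⟨x, rfl⟩, g, hg, rfl⟩ := L.range.exists_add_mem_mem_orthogonal y
    rw [orthogonal_range] at hg
    have hg' : adjoint L g = 0 := hg
    have hJg : J g ∈ L.ker := by
      change L (J g) = 0
      rw [← hJ.apply_apply (L (J g)), ← hadj, hJ.apply_apply, hg', map_zero]
    obtain ⟨u, hu, v, hv, rfl⟩ := L.ker.exists_add_mem_mem_orthogonal x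
    have hu' : L u = 0 := hu
    -- For y = L x + g with g ⊥ ran L: L sees only v, the part of x orthogonal to ker L, while J P
    -- sees only J g ∈ ker L and returns g.
    refine ⟨J g + v, ?_⟩
    have hP : (L.ker.orthogonalProjectionOnto (J g + v) : K) = J g := by
      rw [map_add, Submodule.orthogonalProjectionOnto_apply_of_mem_orthogonal hv,
        add_zero]
      exact L.ker.starProjection_eq_self_iff.2 hJg
    change L (J g + v) + J (L.ker.orthogonalProjectionOnto (J g + v) : K) = L (u + v) + g
    rw [hP, hJ.apply_apply, map_add, map_add, hu', show L (J g) = 0 from hJg]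

theorem IsRFredholm.isJHermitian_sub {J H : K →L[ℂ] K} (hH : IsRFredholm J H) (t : ℝ) :
    IsJHermitian J (H - (t : ℂ) • (1 : K →L[ℂ] K)) := by
  have h : adjoint H * J = J * H := hH.isJHermitian
  have h1 : adjoint (1 : K →L[ℂ] K) = 1 := star_one _
  rw [IsJHermitian, map_sub, map_smulₛₗ, Complex.conj_ofReal, h1, sub_mul, mul_sub, h,
    smul_mul_assoc, mul_smul_comm, one_mul, mul_one]

/-- Near a real point, either the whole neighborhood belongs to the spectrum, or the resolvent has at
most an isolated pole. -/
theorem IsRFredholm.eventually_mem_spectrum_or_exists_pow_smul_resolvent {J H : K →L[ℂ] K}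
    (hJ : IsFundamentalSymmetry J) (hH : IsRFredholm J H) (t : ℝ) :
    (∀ᶠ z in 𝓝 (t : ℂ), z ∈ spectrum ℂ H) ∨
      ∃ (m : ℕ) (C : ℂ → K →L[ℂ] K), ContinuousAt C t ∧
        ∀ᶠ z in 𝓝[≠] (t : ℂ), z ∉ spectrum ℂ H ∧ (z - t) ^ m • resolvent H z = C z := by
  set L := H - (t : ℂ) • (1 : K →L[ℂ] K) with hL
  have hF : IsFredholm L := hH.isFredholm t
  have := hF.finite_ker
  set U : L.ker →L[ℂ] K := J ∘L L.ker.subtypeL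
  set V : K →L[ℂ] L.ker := L.ker.orthogonalProjectionOnto
  have hu : IsUnit (L + U ∘L V) :=
    (hH.isJHermitian_sub t).isUnit_add_comp_orthogonalProjection_ker hJ hF
  let X : ℂ → K →L[ℂ] K := fun z => algebraMap ℂ (K →L[ℂ] K) z - H + (-U) ∘L V
  have hX : AnalyticAt ℂ X t :=
    (((Algebra.linearMap ℂ (K →L[ℂ] K)).toContinuousLinearMap.analyticAt _).sub analyticAt_const).add analyticAt_const
  have hXt : IsUnit (X t) := by
    have : X t = -(L + U ∘L V) := by
      simp only [X, hL, Algebra.algebraMap_eq_smul_one, neg_comp]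
      abel
    rw [this]
    exact hu.neg
  have hXz (z : ℂ) : X z - (-U) ∘L V = algebraMap ℂ (K →L[ℂ] K) z - H := add_sub_cancel_right _ _
  have := eventually_not_isUnit_or_exists_pow_smul_inverse hX hXt (-U) V
  simp only [hXz] at this
  simpa only [spectrum.mem_iff, resolvent, not_not] using this

/-- The resolvent of an `ℝ`-Fredholm operator has at most an isolated pole at every real point. -/
theorem IsRFredholm.exists_pow_smul_resolvent {J H : K →L[ℂ] K}
    (hJ : IsFundamentalSymmetry J) (hH : IsRFredholm J H) (t : ℝ) :
    ∃ (m : ℕ) (C : ℂ → K →L[ℂ] K), ContinuousAt C t ∧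
      ∀ᶠ z in 𝓝[≠] (t : ℂ), z ∉ spectrum ℂ H ∧ (z - t) ^ m • resolvent H z = C z := by
  have hofReal (s : ℝ) : Tendsto ((↑) : ℝ → ℂ) (𝓝[≠] s) (𝓝[≠] (s : ℂ)) :=
    tendsto_nhdsWithin_of_tendsto_nhds_of_eventually_within _
      (Complex.continuous_ofReal.continuousAt.tendsto.mono_left nhdsWithin_le_nhds)
      (eventually_nhdsWithin_of_forall fun x hx => by simpa using hx)
  let S : Set ℝ := {s | ∀ᶠ z in 𝓝 (s : ℂ), z ∈ spectrum ℂ H}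
  have hopen : IsOpen S := by
    have : IsOpen {w : ℂ | ∀ᶠ z in 𝓝 w, z ∈ spectrum ℂ H} := isOpen_setOfPred_eventually_nhds
    exact this.preimage Complex.continuous_ofReal
  have hclosed : IsClosed S := by
    rw [← isOpen_compl_iff, isOpen_iff_mem_nhds]
    intro s hs
    obtain ⟨m, C, -, h⟩ :=
      (hH.eventually_mem_spectrum_or_exists_pow_smul_resolvent hJ s).resolve_left hs
    have h' := (hofReal s).eventually h
    rw [eventually_nhdsWithin_iff] at h'
    filter_upwards [h'] with x hx
    rcases eq_or_ne x s with rfl | hxs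
    · exact hs
    · exact fun hxS => (hx hxs).1 hxS.self_of_nhds
  have hne : S ≠ Set.univ := by
    intro h
    -- A real point outside the norm bound on the spectrum; the factor ‖1‖ covers K = 0.
    have hmem : ‖H‖ * ‖(1 : K →L[ℂ] K)‖ + 1 ∈ S := h ▸ Set.mem_univ _
    refine hmem.self_of_nhds (spectrum.mem_resolventSet_of_norm_lt_mul ?_)
    rw [Complex.norm_real]
    exact (lt_add_one _).trans_le (le_abs_self _)
  have hempty : S = ∅ := (isClopen_iff.1 ⟨hclosed, hopen⟩).resolve_right hne
  exact (hH.eventually_mem_spectrum_or_exists_pow_smul_resolvent hJ t).resolve_left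
    fun h => Set.eq_empty_iff_forall_notMem.1 hempty t h

/-- With trivial kernel the finite rank correction is zero, so H - t itself is invertible. -/
theorem IsRFredholm.hasEigenvalue {J H : K →L[ℂ] K} (hJ : IsFundamentalSymmetry J)
    (hH : IsRFredholm J H) {t : ℝ} (ht : (t : ℂ) ∈ spectrum ℂ H) :
    Module.End.HasEigenvalue (H : K →ₗ[ℂ] K) t := by
  set L := H - (t : ℂ) • (1 : K →L[ℂ] K) with hL
  have hF : IsFredholm L := hH.isFredholm t
  have := hF.finite_ker
  have hu := (hH.isJHermitian_sub t).isUnit_add_comp_orthogonalProjection_ker hJ hF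
  rw [Module.End.hasEigenvalue_iff, ne_eq, Submodule.eq_bot_iff]
  intro h
  have hker (x : K) (hx : x ∈ L.ker) : x = 0 := by
    refine h x (Module.End.mem_eigenspace_iff.2 ?_)
    exact sub_eq_zero.1 (show L x = 0 from hx)
  have hzero : (J ∘L L.ker.subtypeL) ∘L L.ker.orthogonalProjectionOnto = 0 := by
    ext x
    change J (L.ker.orthogonalProjectionOnto x : K) = 0
    rw [hker _ (L.ker.orthogonalProjectionOnto x).2, map_zero]
  rw [← hL, hzero, add_zero] at hu
  refine ht ?_
  have : algebraMap ℂ (K →L[ℂ] K) t - H = -L := by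
    rw [hL, Algebra.algebraMap_eq_smul_one, neg_sub]
  rw [spectrum.mem_resolventSet_iff, this]
  exact hu.neg

theorem IsRFredholm.isDiscreteEigenvalue {J H : K →L[ℂ] K} (hJ : IsFundamentalSymmetry J)
    (hH : IsRFredholm J H) {t : ℝ} (ht : (t : ℂ) ∈ spectrum ℂ H) :
    IsDiscreteEigenvalue H (t : ℂ) := by
  refine ⟨hH.hasEigenvalue hJ ht, ?_⟩
  obtain ⟨m, C, hC, hev⟩ := hH.exists_pow_smul_resolvent hJ t
  have hev' := eventually_nhdsWithin_iff.1 hev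
  obtain ⟨r, hr, hball⟩ := Metric.nhds_basis_closedBall.eventually_iff.1 hev'
  refine ⟨r, hr, ?_, ?_⟩
  · refine Set.Subset.antisymm (fun z hz => ?_) ?_
    · by_contra hzt
      exact (hball hz.1 hzt).1 hz.2
    · rintro _ rfl
      exact ⟨Metric.mem_closedBall_self hr.le, ht⟩
  · set B : K →L[ℂ] K := algebraMap ℂ (K →L[ℂ] K) t - H with hB
    have hzero := exists_pow_mul_circleIntegral_resolvent_eq_zero hr.le
      (fun z hz hzt => (hball hz hzt).1) hC (hev.mono fun z hz => hz.2)
    have hfin : FiniteDimensional ℂ (LinearMap.ker (B : K →ₗ[ℂ] K)) := by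
      have hker : LinearMap.ker (B : K →ₗ[ℂ] K) = (H - (t : ℂ) • (1 : K →L[ℂ] K)).ker := by
        ext x
        change (t : ℂ) • x - H x = 0 ↔ H x - (t : ℂ) • x = 0
        rw [sub_eq_zero, sub_eq_zero, eq_comm]
      rw [hker]
      exact (hH.isFredholm t).finite_ker
    have := Module.End.finiteDimensional_ker_pow (B : K →ₗ[ℂ] K) (m + 1)
    refine Submodule.finiteDimensional_of_le (S₂ := LinearMap.ker ((B : K →ₗ[ℂ] K) ^ (m + 1))) ?_
    rintro _ ⟨x, rfl⟩
    have h0 : B ^ (m + 1) * rieszProjection H t r = 0 := by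
      rw [rieszProjection, mul_smul_comm, hzero, smul_zero]
    have h1 := congr($h0 x)
    rw [LinearMap.mem_ker, ← ContinuousLinearMap.toLinearMap_pow]
    exact h1

theorem IsRFredholm.finite_real_spectrum {J H : K →L[ℂ] K} (hJ : IsFundamentalSymmetry J)
    (hH : IsRFredholm J H) : {t : ℝ | (t : ℂ) ∈ spectrum ℂ H}.Finite := by
  by_contra hinf
  have hcomp : IsCompact {t : ℝ | (t : ℂ) ∈ spectrum ℂ H} :=
    Complex.isometry_ofReal.isClosedEmbedding.isCompact_preimage (spectrum.isCompact H)
  obtain ⟨t, -, ht⟩ := Set.Infinite.exists_accPt_of_subset_isCompact hinf hcomp subset_rfl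
  obtain ⟨m, C, -, h⟩ := hH.exists_pow_smul_resolvent hJ t
  refine accPt_iff_frequently_nhdsNE.1 ht ?_
  have hofReal : Tendsto ((↑) : ℝ → ℂ) (𝓝[≠] t) (𝓝[≠] (t : ℂ)) :=
    tendsto_nhdsWithin_of_tendsto_nhds_of_eventually_within _
      (Complex.continuous_ofReal.continuousAt.tendsto.mono_left nhdsWithin_le_nhds)
      (eventually_nhdsWithin_of_forall fun x hx => by simpa using hx)
  filter_upwards [hofReal.eventually h] with x hx
  exact hx.1

end Krein

theorem mainTheorem4 {K : Type*} [NormedAddCommGroup K] [InnerProductSpace ℂ K] [CompleteSpace K]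
    [TopologicalSpace.SeparableSpace K] (J : K →L[ℂ] K) (hJ : IsFundamentalSymmetry J)
    (H : K →L[ℂ] K) (hH : IsRFredholm J H) :
    (∀ t : ℝ, (t : ℂ) ∈ spectrum ℂ H → IsDiscreteEigenvalue H (t : ℂ)) ∧
      {t : ℝ | (t : ℂ) ∈ spectrum ℂ H}.Finite :=
  ⟨fun _ ht => hH.isDiscreteEigenvalue hJ ht, hH.finite_real_spectrum hJ⟩
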